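/- **Model.** In the CongestedClique there are $n$ machines with identifiers $1,\dots,n$. Computation proceeds in synchronous rounds; in each round every machine performs unbounded local computation and then sends a (possibly different) message of $O(\log n)$ bits to every other machine. Let $\alpha$ be such that, for every constant $k$, two $n\times n$ integer matrices with entries of absolute value at most $n^k$ can be multiplied in $O(n^\alpha)$ rounds by a deterministic CongestedClique algorithm, where machine $i$ is given row $i$ of both factors and outputs row $i$ of the product. **Shortcut graph.** Let $G=(V,E)$ be a connected, simple, undirected, unweighted graph with $V=\{1,\dots,n\}$, and let $S\subseteq V$. For $u,v\in V$ let $x_0=u,x_1,x_2,\dots$ be the simple random walk on $G$ from $u$ (each step goes to a uniformly random neighbour), let $j=\min\{i>0 : x_i\in S\}$, and let $\mathbf Q[u,v]=\Pr[x_{j-1}=v]$ (the probability that $j$ exists and $x_{j-1}=v$). $\mathbf Q$ is the transition matrix of $\mathrm{ShortCut}(G,S)$. **Statement.** Let $c>0$ and $a>0$ be constants. There are constants $b,k,C$, depending only on $\alpha$, $c$ and $a$, such that for every $n\ge 2$ and every $\beta\ge a/n^{c}$ there is a deterministic CongestedClique algorithm on $n$ machines, with messages of $b\lceil\log_2 n\rceil$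 bits and running for at most $C\,n^{\alpha}(\log n)^k$ rounds (that is, $\tilde O(n^\alpha)$ rounds), with the following property. For every connected graph $G$ on $\{1,\dots,n\}$ and every $S\subseteq V$, if machine $i$ is initially given only the set of neighbours of vertex $i$ and whether $i\in S$, then there is a rational matrix $\mathbf Q'$ with $$\mathbf Q[u,v]-\beta\;\le\;\mathbf Q'[u,v]\;\le\;\mathbf Q[u,v]\qquad\text{for all }u,v\in V,$$ and each machine $i$ outputs row $i$ and column $i$ of $\mathbf Q'$. In other words, $\mathrm{ShortCut}(G,S)$ can be computed with subtractive error at most $\beta$ in $\tilde O(n^\alpha)$ rounds. -/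

import Mathlib

open MeasureTheory ProbabilityTheory

noncomputable section

namespace CongestedClique

/-- A message of `w` bits. -/
abbrev Msg (w : ℕ) : Type := Fin w → Bool

/-- A deterministic synchronous protocol on the clique of machines `0, …, n - 1`, in which every
machine has a local input in `I` and a local output in `O`, and in every round every machine sends
a (possibly different) `w`-bit message to every machine. Local computation is unbounded: the maps
below are arbitrary functions of the identifier and the local state of the machine. -/
structure Protocol (n w : ℕ) (I O : Type) where
  /-- Local states of the machines. -/
  State : Type
  /-- `init i a` is the initial state of machine `i` with local input `a`. -/
  init : Fin n → I → State
  /-- `send i s j` is the message that machine `i` sends to machine `j` when in state `s`. -/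
  send : Fin n → State → Fin n → Msg w
  /-- `recv i s m` is the next state of machine `i` in state `s` that receives the message
  `m j` from each machine `j`. -/
  recv : Fin n → State → (Fin n → Msg w) → State
  /-- `out i s` is the output of machine `i` when it stops in state `s`. -/
  out : Fin n → State → O

/-- The local states after `t` rounds, when machine `i` has local input `x i`. -/
def Protocol.run {n w : ℕ} {I O : Type} (A : Protocol n w I O) (x : Fin n → I) :
    ℕ → Fin n → A.State
  | 0 => fun i => A.init i (x i)
  | t + 1 => fun i => A.recv i (A.run x t i) (fun j => A.send j (A.run x t j) i)

/-- The local outputs after `T` rounds. -/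
def Protocol.output {n w : ℕ} {I O : Type} (A : Protocol n w I O) (x : Fin n → I) (T : ℕ)
    (i : Fin n) : O :=
  A.out i (A.run x T i)

/-- `n × n` integer matrices with entries of `O(log n)` bits (that is, of absolute value at most
`n ^ k` for a constant `k`) can be multiplied in `O(n ^ α)` rounds with messages of `O(log n)` bits.
Machine `i` is given row `i` of each factor and has to output row `i` of the product. -/
def MatMulInRounds (α : ℝ) : Prop :=
  ∀ k : ℕ, ∃ (b : ℕ) (C : ℝ), ∀ n : ℕ, 2 ≤ n →
    ∃ (A : Protocol n (b * Nat.clog 2 n) ((Fin n → ℤ) × (Fin n → ℤ)) (Fin n → ℤ)) (T : ℕ),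
      (T : ℝ) ≤ C * (n : ℝ) ^ α ∧
      ∀ X Y : Matrix (Fin n) (Fin n) ℤ,
        (∀ i j, |X i j| ≤ (n : ℤ) ^ k) → (∀ i j, |Y i j| ≤ (n : ℤ) ^ k) →
        ∀ i, A.output (fun m => (X m, Y m)) T i = (X * Y) i

end CongestedClique

namespace RandomWalk

open Classical in
/-- One step of the random walk on `G` from `u`: a uniformly random neighbour of `u`.
(If `u` has no neighbour, the walk stays at `u`.) -/
def step {n : ℕ} (G : SimpleGraph (Fin n)) (u : Fin n) : PMF (Fin n) :=
  if h : (G.neighborFinset u).Nonempty then PMF.uniformOfFinset (G.neighborFinset u) h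
  else PMF.pure u

/-- The law of `x (k + 1)` given the history `x 0, …, x k` of the walk: a step from `x k`. -/
def stepKernel {n : ℕ} (G : SimpleGraph (Fin n)) (k : ℕ) :
    Kernel (Finset.Iic k → Fin n) (Fin n) :=
  Kernel.ofFunOfCountable fun x : Finset.Iic k → Fin n =>
    (step G (x ⟨k, Finset.mem_Iic.2 le_rfl⟩)).toMeasure

instance stepKernel_isMarkov {n : ℕ} (G : SimpleGraph (Fin n)) (k : ℕ) : IsMarkovKernel (stepKernel G k) :=
  ⟨fun _ => PMF.toMeasure.isProbabilityMeasure _⟩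

/-- The law of the random walk `x 0 = u, x 1, x 2, …` on `G`. -/
def walk {n : ℕ} (G : SimpleGraph (Fin n)) (u : Fin n) : Measure (ℕ → Fin n) :=
  Kernel.traj (X := fun _ => Fin n) (stepKernel G) 0 (fun _ => u)

/-- The transition matrix of the shortcut graph of `G` and `S`: the entry at `(u, v)` is the
probability that the random walk `x` on `G` from `u` satisfies `x (j - 1) = v`, where
`j = min {i > 0 | x i ∈ S}`. (The event requires that there is such an `i`.) -/
def shortcut {n : ℕ} (G : SimpleGraph (Fin n)) (S : Set (Fin n)) : Matrix (Fin n) (Fin n) ℝ :=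
  fun u v => (walk G u).real {x | ∃ j, IsLeast {i : ℕ | 0 < i ∧ x i ∈ S} j ∧ x (j - 1) = v}

end RandomWalk

/-- `M'` approximates `M` with subtractive error at most `β`: every entry of `M'` is at most the
entry of `M`, and smaller by at most `β`. -/
def SubtractiveApprox {n : ℕ} (M : Matrix (Fin n) (Fin n) ℝ) (M' : Matrix (Fin n) (Fin n) ℚ)
    (β : ℝ) : Prop :=
  ∀ u v, (M' u v : ℝ) ≤ M u v ∧ M u v - β ≤ (M' u v : ℝ)

end

/-! Let `A = avoid G S` be the walk's transition matrix with the steps into `S` deleted, and `B =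
enter G S` the diagonal matrix of the probabilities of stepping into `S`. Splitting by the time of
the last step before `S` gives `Q = ∑ t, A ^ t * B`. The partial sums `B_t = absorbed A B t` satisfy
`B_{2t} = B_t + A ^ t * B_t`, so `2 ^ L` steps cost `L` squarings of two matrix products each.

Truncation loses at most the probability of avoiding `S` throughout those steps. A Dirichlet energy
estimate (`le_of_laplacian_le`) bounds truncated expected hitting times by `2 * n ^ 4`, so this loss
is at most `2 * n ^ 4 / (2 ^ L - 1)` (`mul_sum_avoid_pow_le`).

The products are computed on integers in units of `1 / N`, always rounded down, so the error is
one-sided. Row errors grow at most fourfold per squaring (`IsChain.below_squaring`). Taking `L =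
O(log n)` and `N` a fixed power of `n` makes both errors smaller than any prescribed inverse power
of `n`, while the entries keep `O(log n)` bits. One round announces `S` beforehand, and one
transposes the result at the end (`reaches_approx`). -/

namespace CongestedClique

/-! ### Composing protocols and counting rounds -/

/-- On every instance `ω`, machines with local knowledge `K ω` can reach the local knowledge `K' ω`
within exactly `T` rounds with messages of `w` bits. -/
def Reaches {n : ℕ} (w T : ℕ) {Ω I O : Type} (K : Ω → Fin n → I) (K' : Ω → Fin n → O) : Prop :=
  ∃ A : Protocol n w I O, ∀ ω i, A.output (K ω) T i = K' ω i

section Reaches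

variable {n w w' : ℕ} {Ω I O J : Type}

theorem Reaches.local {K : Ω → Fin n → I} {K' : Ω → Fin n → O} (f : Fin n → I → O)
    (h : ∀ ω i, K' ω i = f i (K ω i)) : Reaches w 0 K K' :=
  ⟨⟨I, fun _ a => a, fun _ _ _ _ => false, fun _ s _ => s, f⟩, fun ω i => (h ω i).symm⟩

/-- The protocol that runs `A` for `T` rounds and then `B` on its outputs. -/
def Protocol.andThen (A : Protocol n w I O) (T : ℕ) (B : Protocol n w O J) :
    Protocol n w I J :=
  -- The handover happens in the same round in which `A` finishes, or already in `init` if `T = 0`,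
  -- so no round is lost between the two protocols.
  let switch : Fin n → ℕ × A.State → (ℕ × A.State) ⊕ B.State := fun i p =>
    if p.1 = T then Sum.inr (B.init i (A.out i p.2)) else Sum.inl p
  { State := (ℕ × A.State) ⊕ B.State
    init := fun i a => switch i (0, A.init i a)
    send := fun i s j => Sum.elim (fun p => A.send i p.2 j) (fun s => B.send i s j) s
    recv := fun i s m => Sum.elim (fun p => switch i (p.1 + 1, A.recv i p.2 m))
      (fun s => Sum.inr (B.recv i s m)) s
    out := fun i s => Sum.elim (fun p => B.out i (B.init i (A.out i p.2))) (B.out i) s }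

theorem Protocol.andThen_run_le (A : Protocol n w I O) (T : ℕ) (B : Protocol n w O J)
    (x : Fin n → I) (t : ℕ) (ht : t ≤ T) :
    (A.andThen T B).run x t = fun i =>
      if t = T then Sum.inr (B.init i (A.out i (A.run x t i))) else Sum.inl (t, A.run x t i) := by
  induction t with
  | zero => rfl
  | succ t ih =>
    have hne : t ≠ T := by omega
    funext i
    rw [Protocol.run, ih (by omega)]
    simp only [if_neg hne]
    rfl

theorem Protocol.andThen_run_add (A : Protocol n w I O) (T : ℕ) (B : Protocol n w O J)
    (x : Fin n → I) (t : ℕ) :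
    (A.andThen T B).run x (T + t) = fun i => Sum.inr (B.run (A.output x T) t i) := by
  induction t with
  | zero =>
    rw [Nat.add_zero, A.andThen_run_le T B x T le_rfl]
    simp only [if_true]
    rfl
  | succ t ih =>
    funext i
    rw [← Nat.add_assoc, Protocol.run, ih]
    rfl

theorem Reaches.trans {T T' : ℕ} {K : Ω → Fin n → I} {K' : Ω → Fin n → O} {K'' : Ω → Fin n → J}
    (h : Reaches w T K K') (h' : Reaches w T' K' K'') : Reaches w (T + T') K K'' := by
  obtain ⟨A, hA⟩ := h
  obtain ⟨B, hB⟩ := h'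
  refine ⟨A.andThen T B, fun ω i => ?_⟩
  have : A.output (K ω) T = K' ω := funext (hA ω)
  rw [← hB ω i, Protocol.output, Protocol.andThen_run_add, this]
  rfl

/-- Machines may keep additional local knowledge while they run a protocol. -/
theorem Reaches.keep {T : ℕ} {K : Ω → Fin n → I} {K' : Ω → Fin n → O}
    (h : Reaches w T K K') (L : Ω → Fin n → J) :
    Reaches w T (fun ω i => (K ω i, L ω i)) (fun ω i => (K' ω i, L ω i)) := by
  obtain ⟨A, hA⟩ := h
  let B : Protocol n w (I × J) (O × J) := ⟨A.State × J, fun i a => (A.init i a.1, a.2),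
    fun i s => A.send i s.1, fun i s m => (A.recv i s.1 m, s.2), fun i s => (A.out i s.1, s.2)⟩
  refine ⟨B, fun ω i => ?_⟩
  have key : ∀ t, B.run (fun i => (K ω i, L ω i)) t = fun i => (A.run (K ω) t i, L ω i) := by
    intro t
    induction t with
    | zero => rfl
    | succ t ih =>
      funext i
      rw [Protocol.run, ih]
      rfl
  change B.output (fun i => (K ω i, L ω i)) T i = (K' ω i, L ω i)
  rw [← hA ω i, Protocol.output, key]
  rfl

theorem Reaches.mono_width {T : ℕ} {K : Ω → Fin n → I} {K' : Ω → Fin n → O}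
    (h : Reaches w T K K') (hw : w ≤ w') : Reaches w' T K K' := by
  obtain ⟨A, hA⟩ := h
  let B : Protocol n w' I O := ⟨A.State, A.init,
    fun i s j b => if hb : b.1 < w then A.send i s j ⟨b, hb⟩ else false,
    fun i s m => A.recv i s (fun j b => m j (Fin.castLE hw b)), A.out⟩
  refine ⟨B, fun ω i => ?_⟩
  have key : ∀ t, B.run (K ω) t = A.run (K ω) t := by
    intro t
    induction t with
    | zero => rfl
    | succ t ih =>
      funext i
      rw [Protocol.run, ih, Protocol.run]
      simp [B]
  rw [← hA ω i, Protocol.output, key, Protocol.output]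

/-- In one round, every machine can send a `w`-bit message to every machine. -/
theorem Reaches.exchange (K : Ω → Fin n → I) (f : Fin n → I → Fin n → Msg w) :
    Reaches w 1 K (fun ω i => (fun j => f j (K ω j) i, K ω i)) := by
  refine ⟨⟨(Fin n → Msg w) × I, fun _ a => (fun _ _ => false, a), fun i s => f i s.2,
    fun _ s m => (m, s.2), fun _ s => s⟩, fun ω i => rfl⟩

end Reaches

/-- Messages of `w` bits can carry a natural number below `2 ^ w`. -/
theorem Reaches.exchange_nat {n w : ℕ} {Ω I : Type} (K : Ω → Fin n → I)
    (f : Fin n → I → Fin n → ℕ) (hf : ∀ ω i j, f i (K ω i) j < 2 ^ w) :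
    Reaches w 1 K (fun ω i => (fun j => f j (K ω j) i, K ω i)) := by
  have := Reaches.exchange (w := w) K (fun i a j b => (f i a j).testBit b)
  refine this.trans (T' := 0) (Reaches.local
    (fun i p => (fun j => Nat.ofBits (p.1 j), p.2)) fun ω i => ?_)
  simp only [Prod.mk.injEq, and_true]
  funext j
  rw [Nat.ofBits_testBit, Nat.mod_eq_of_lt (hf ω j i)]

/-- The exponent of matrix multiplication is nonnegative. -/
theorem MatMulInRounds.nonneg {α : ℝ} (h : MatMulInRounds α) : 0 ≤ α := by
  by_contra! hα
  obtain ⟨b, C, h⟩ := h 0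
  -- For `α < 0` the round bound tends to zero, so some `n` would allow no communication at all.
  have hlim : Filter.Tendsto (fun n : ℕ => C * (n : ℝ) ^ α) Filter.atTop (nhds (C * 0)) := by
    refine Filter.Tendsto.const_mul C ?_
    have := (tendsto_rpow_neg_atTop (y := -α) (by linarith)).comp tendsto_natCast_atTop_atTop
    simpa [Function.comp_def] using this
  rw [mul_zero] at hlim
  obtain ⟨n, hn, hn2⟩ := ((hlim.eventually (gt_mem_nhds one_pos)).and
    (Filter.eventually_ge_atTop 2)).exists
  obtain ⟨A, T, hT, hA⟩ := h n hn2
  have hT0 : T = 0 := by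
    have : (T : ℝ) < 1 := lt_of_le_of_lt hT hn
    exact_mod_cast Nat.lt_one_iff.1 (by exact_mod_cast this)
  subst hT0
  -- `Y` differs from `0` only in row `v`, which machine `u` never sees, yet row `u` of the product
  -- changes.
  let u : Fin n := ⟨0, by omega⟩
  let v : Fin n := ⟨1, by omega⟩
  have huv : u ≠ v := by simp [u, v, Fin.ext_iff]
  let X : Matrix (Fin n) (Fin n) ℤ := fun _ _ => 1
  let Y : Matrix (Fin n) (Fin n) ℤ := fun i _ => if i = v then 1 else 0
  have h1 := hA X 0 (by simp [X]) (by simp) u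
  have h2 := hA X Y (by simp [X]) (by intro i j; simp only [Y]; split_ifs <;> simp) u
  have h3 : A.output (fun m => (X m, (0 : Matrix (Fin n) (Fin n) ℤ) m)) 0 u =
      A.output (fun m => (X m, Y m)) 0 u := by
    have : (0 : Matrix (Fin n) (Fin n) ℤ) u = Y u := by
      funext j
      simp [Y, if_neg huv]
    simp only [Protocol.output, Protocol.run, this]
  have h4 := congrFun (h1.symm.trans (h3.trans h2)) u
  rw [Matrix.mul_apply, Matrix.mul_apply] at h4
  simp [X, Y] at h4

/-- `T` is fixed before `Ω`, so all products in the repeated squaring share one round count. -/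
theorem MatMulInRounds.reaches {α : ℝ} (h : MatMulInRounds α) (k : ℕ) :
    ∃ (b : ℕ) (C : ℝ), ∀ n : ℕ, 2 ≤ n → ∃ T : ℕ, (T : ℝ) ≤ C * (n : ℝ) ^ α ∧
      ∀ {Ω : Type} (X Y : Ω → Matrix (Fin n) (Fin n) ℤ),
        (∀ ω i j, |X ω i j| ≤ (n : ℤ) ^ k) → (∀ ω i j, |Y ω i j| ≤ (n : ℤ) ^ k) →
        Reaches (b * Nat.clog 2 n) T (fun ω i => (X ω i, Y ω i)) (fun ω i => (X ω * Y ω) i) := by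
  obtain ⟨b, C, h⟩ := h k
  refine ⟨b, C, fun n hn => ?_⟩
  obtain ⟨A, T, hT, hA⟩ := h n hn
  exact ⟨T, hT, fun X Y hX hY => ⟨A, fun ω i => hA (X ω) (Y ω) (hX ω) (hY ω) i⟩⟩

end CongestedClique

/-! ### Repeated squaring of an absorbing chain in fixed-point arithmetic -/

namespace AbsorbingChain

open Matrix

variable {ι : Type*} [Fintype ι]

/-- `absorbed A B t` holds the probabilities of absorption within `t` steps, for a chain with
transient part `A` and one-step absorption probabilities `B`. -/
def absorbed [DecidableEq ι] (A B : Matrix ι ι ℝ) (t : ℕ) : Matrix ι ι ℝ := ∑ s ∈ Finset.range t, A ^ s * B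

/-- Absorption occurs within the first `s` steps, or the chain survives them and is absorbed in the
next `t`. The case `s = t` is the doubling step. -/
theorem absorbed_add [DecidableEq ι] (A B : Matrix ι ι ℝ) (s t : ℕ) :
    absorbed A B (s + t) = absorbed A B s + A ^ s * absorbed A B t := by
  simp only [absorbed, Finset.sum_range_add, Matrix.mul_sum, pow_add, Matrix.mul_assoc]

/-- The two blocks of the transition matrix of an absorbing chain: nonnegative matrices whose rows
have total mass one. -/
structure IsChain (A B : Matrix ι ι ℝ) : Prop where
  nonneg_left : ∀ u v, 0 ≤ A u v
  nonneg_right : ∀ u v, 0 ≤ B u v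
  row_sum : ∀ u, ∑ v, A u v + ∑ v, B u v = 1

theorem mul_nonneg_apply {A B : Matrix ι ι ℝ} (hA : ∀ u v, 0 ≤ A u v) (hB : ∀ u v, 0 ≤ B u v)
    (u v : ι) : 0 ≤ (A * B) u v := by
  rw [Matrix.mul_apply]
  exact Finset.sum_nonneg fun w _ => mul_nonneg (hA _ _) (hB _ _)

theorem row_sum_mul (A B : Matrix ι ι ℝ) (u : ι) :
    ∑ v, (A * B) u v = ∑ w, A u w * ∑ v, B w v := by
  simp only [Matrix.mul_apply, Finset.mul_sum]
  exact Finset.sum_comm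

/-- Two steps of size `s` and `t` combine to a step of size `s + t`. -/
theorem IsChain.comp {A B A' B' : Matrix ι ι ℝ} (h : IsChain A B) (h' : IsChain A' B') :
    IsChain (A * A') (B + A * B') where
  nonneg_left := mul_nonneg_apply h.nonneg_left h'.nonneg_left
  nonneg_right u v := add_nonneg (h.nonneg_right u v)
    (mul_nonneg_apply h.nonneg_left h'.nonneg_right u v)
  row_sum u := by
    simp only [Matrix.add_apply, Finset.sum_add_distrib, row_sum_mul]
    have : ∑ w, A u w * ∑ v, A' w v + ∑ w, A u w * ∑ v, B' w v = ∑ w, A u w := by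
      rw [← Finset.sum_add_distrib]
      refine Finset.sum_congr rfl fun w _ => ?_
      rw [← mul_add, h'.row_sum, mul_one]
    linarith [h.row_sum u]

theorem IsChain.pow [DecidableEq ι] {A B : Matrix ι ι ℝ} (h : IsChain A B) (t : ℕ) :
    IsChain (A ^ t) (absorbed A B t) := by
  induction t with
  | zero =>
    refine ⟨fun u v => ?_, by simp [absorbed], by simp [absorbed, Matrix.one_apply]⟩
    rw [pow_zero, Matrix.one_apply]
    split_ifs <;> norm_num
  | succ t ih =>
    have := ih.comp h
    rw [pow_succ, absorbed_add]
    simpa [absorbed] using this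

/-- Fixed-point approximations of the blocks of the `2 ^ i`-step chain, with unit `1 / N`. -/
def squaring (N : ℤ) (A₀ B₀ : Matrix ι ι ℤ) : ℕ → Matrix ι ι ℤ × Matrix ι ι ℤ
  | 0 => (A₀, B₀)
  | i + 1 =>
    let p := squaring N A₀ B₀ i
    ((p.1 * p.1).map (· / N), p.2 + (p.1 * p.2).map (· / N))

/-- `X / N` is a lower bound of the nonnegative matrix `A` with row errors at most `e`. -/
structure Below (N : ℤ) (e : ℝ) (X : Matrix ι ι ℤ) (A : Matrix ι ι ℝ) : Prop where
  nonneg : ∀ u v, 0 ≤ X u v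
  le : ∀ u v, (X u v : ℝ) / N ≤ A u v
  row : ∀ u, ∑ v, (A u v - X u v / N) ≤ e

variable {N : ℤ}

theorem sub_div_floor_le (hN : 0 < N) (z : ℤ) :
    ((z / N : ℤ) : ℝ) ≤ z / N ∧ (z : ℝ) / N - 1 ≤ ((z / N : ℤ) : ℝ) := by
  have hN' : (0 : ℝ) < N := by exact_mod_cast hN
  constructor
  · rw [le_div_iff₀ hN']
    exact_mod_cast Int.ediv_mul_le z hN.ne'
  · rw [sub_le_iff_le_add, div_le_iff₀ hN']
    have := Int.lt_ediv_add_one_mul_self z hN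
    exact_mod_cast this.le

theorem Below.floor (hN : 0 < N) {A : Matrix ι ι ℝ} (hA : ∀ u v, 0 ≤ A u v) :
    Below N (Fintype.card ι / N) (A.map fun a => ⌊(N : ℝ) * a⌋) A := by
  have hN' : (0 : ℝ) < N := by exact_mod_cast hN
  refine ⟨fun u v => Int.floor_nonneg.2 (mul_nonneg hN'.le (hA u v)), fun u v => ?_, fun u => ?_⟩
  · rw [div_le_iff₀ hN', mul_comm]
    exact Int.floor_le _
  · have : ∀ v, A u v - ((A.map fun a => ⌊(N : ℝ) * a⌋) u v : ℝ) / N ≤ 1 / N := by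
      intro v
      rw [sub_le_iff_le_add, ← add_div, le_div_iff₀ hN', mul_comm]
      simp only [Matrix.map_apply]
      linarith [Int.lt_floor_add_one ((N : ℝ) * A u v)]
    calc _ ≤ ∑ v : ι, (1 : ℝ) / N := Finset.sum_le_sum fun v _ => this v
      _ = _ := by simp [div_eq_mul_inv]

/-- Writing `X`, `Y` for the scaled matrices, `A * B - X * Y = A * (B - Y) + (A - X) * Y`. Because
errors are measured by row sums and the rows of `A` and `Y` have mass at most one, `e` and `f`
merely add; rounding down costs `1 / N` per entry. -/
theorem Below.mul_div (hN : 0 < N) {X Y : Matrix ι ι ℤ} {A B : Matrix ι ι ℝ} {e f : ℝ}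
    (hX : Below N e X A) (hY : Below N f Y B) (hA : ∀ u, ∑ v, A u v ≤ 1)
    (hB : ∀ u, ∑ v, B u v ≤ 1) :
    Below N (e + f + Fintype.card ι / N) ((X * Y).map (· / N)) (A * B) := by
  have hN' : (0 : ℝ) < N := by exact_mod_cast hN
  have hX0 : ∀ u v, (0 : ℝ) ≤ X u v / N := fun u v =>
    div_nonneg (by exact_mod_cast hX.nonneg u v) hN'.le
  have hY0 : ∀ u v, (0 : ℝ) ≤ Y u v / N := fun u v =>
    div_nonneg (by exact_mod_cast hY.nonneg u v) hN'.le
  have hA0 : ∀ u v, 0 ≤ A u v := fun u v => (hX0 u v).trans (hX.le u v)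
  have hprod : ∀ u v, ((X * Y) u v : ℝ) / N / N = ∑ w, (X u w : ℝ) / N * (Y w v / N) := by
    intro u v
    rw [Matrix.mul_apply]
    push_cast
    rw [Finset.sum_div, Finset.sum_div]
    exact Finset.sum_congr rfl fun w _ => by ring
  refine ⟨fun u v => ?_, fun u v => ?_, fun u => ?_⟩
  · refine Int.ediv_nonneg ?_ hN.le
    rw [Matrix.mul_apply]
    exact Finset.sum_nonneg fun w _ => mul_nonneg (hX.nonneg _ _) (hY.nonneg _ _)
  · calc _ ≤ ((X * Y) u v : ℝ) / N / N := by
          refine div_le_div_of_nonneg_right ?_ hN'.le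
          exact (sub_div_floor_le hN _).1
      _ ≤ _ := by
          rw [hprod, Matrix.mul_apply]
          exact Finset.sum_le_sum fun w _ => mul_le_mul (hX.le _ _) (hY.le _ _) (hY0 _ _) (hA0 _ _)
  · have h1 : ∀ v, (A * B) u v - (((X * Y).map (· / N)) u v : ℝ) / N ≤
        ∑ w, A u w * (B w v - Y w v / N) + ∑ w, (A u w - X u w / N) * (Y w v / N) + 1 / N := by
      intro v
      have h2 : ((X * Y) u v : ℝ) / N / N - 1 / N ≤ (((X * Y).map (· / N)) u v : ℝ) / N := by
        rw [← sub_div]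
        exact div_le_div_of_nonneg_right (sub_div_floor_le hN _).2 hN'.le
      rw [hprod] at h2
      rw [Matrix.mul_apply, ← Finset.sum_add_distrib]
      have h3 : ∀ w, A u w * (B w v - Y w v / N) + (A u w - X u w / N) * (Y w v / N) =
          A u w * B w v - (X u w : ℝ) / N * (Y w v / N) := fun w => by ring
      simp only [h3, Finset.sum_sub_distrib]
      linarith
    have h4 : ∑ v, ∑ w, A u w * (B w v - Y w v / N) ≤ f := by
      rw [Finset.sum_comm]
      simp only [← Finset.mul_sum]
      have hf : 0 ≤ f := (Finset.sum_nonneg fun v _ => sub_nonneg.2 (hY.le u v)).trans (hY.row u)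
      calc _ ≤ ∑ w, A u w * f :=
            Finset.sum_le_sum fun w _ => mul_le_mul_of_nonneg_left (hY.row w) (hA0 _ _)
        _ = (∑ w, A u w) * f := by rw [Finset.sum_mul]
        _ ≤ 1 * f := mul_le_mul_of_nonneg_right (hA u) hf
        _ = f := one_mul f
    have h5 : ∑ v, ∑ w, (A u w - X u w / N) * ((Y w v : ℝ) / N) ≤ e := by
      rw [Finset.sum_comm]
      simp only [← Finset.mul_sum]
      calc _ ≤ ∑ w, (A u w - X u w / N) * 1 := by
            refine Finset.sum_le_sum fun w _ =>
              mul_le_mul_of_nonneg_left ?_ (sub_nonneg.2 (hX.le _ _))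
            exact (Finset.sum_le_sum fun v _ => hY.le w v).trans (hB w)
        _ ≤ e := by simpa only [mul_one] using hX.row u
    calc _ ≤ ∑ v, (∑ w, A u w * (B w v - Y w v / N) +
          ∑ w, (A u w - X u w / N) * (Y w v / N) + 1 / N) := Finset.sum_le_sum fun v _ => h1 v
      _ ≤ _ := by
        rw [Finset.sum_add_distrib, Finset.sum_add_distrib]
        have : ∑ v : ι, (1 : ℝ) / N = Fintype.card ι / N := by simp [div_eq_mul_inv]
        linarith

theorem Below.add {X Y : Matrix ι ι ℤ} {A B : Matrix ι ι ℝ} {e f : ℝ}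
    (hX : Below N e X A) (hY : Below N f Y B) : Below N (e + f) (X + Y) (A + B) := by
  refine ⟨fun u v => add_nonneg (hX.nonneg u v) (hY.nonneg u v), fun u v => ?_, fun u => ?_⟩
  · simp only [Matrix.add_apply, Int.cast_add, add_div]
    exact add_le_add (hX.le u v) (hY.le u v)
  · calc _ = ∑ v, (A u v - X u v / N) + ∑ v, (B u v - Y u v / N) := by
          rw [← Finset.sum_add_distrib]
          refine Finset.sum_congr rfl fun v _ => ?_
          simp only [Matrix.add_apply, Int.cast_add]
          ring
      _ ≤ _ := add_le_add (hX.row u) (hY.row u)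

theorem Below.mono {X : Matrix ι ι ℤ} {A : Matrix ι ι ℝ} {e f : ℝ} (h : Below N e X A)
    (hef : e ≤ f) : Below N f X A :=
  ⟨h.nonneg, h.le, fun u => (h.row u).trans hef⟩

theorem IsChain.left_row_le {A B : Matrix ι ι ℝ} (h : IsChain A B) (u : ι) :
    ∑ v, A u v ≤ 1 := by
  linarith [h.row_sum u, Finset.sum_nonneg fun v (_ : v ∈ Finset.univ) => h.nonneg_right u v]

theorem IsChain.right_row_le {A B : Matrix ι ι ℝ} (h : IsChain A B) (u : ι) :
    ∑ v, B u v ≤ 1 := by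
  linarith [h.row_sum u, Finset.sum_nonneg fun v (_ : v ∈ Finset.univ) => h.nonneg_left u v]

/-- Keeps every intermediate matrix within the entry bound that fast multiplication requires. -/
theorem Below.abs_le (hN : 0 < N) {X : Matrix ι ι ℤ} {A : Matrix ι ι ℝ} {e : ℝ}
    (h : Below N e X A) (hA : ∀ u, ∑ v, A u v ≤ 1) (u v : ι) : |X u v| ≤ N := by
  have hN' : (0 : ℝ) < N := by exact_mod_cast hN
  have h0 : ∀ v, 0 ≤ A u v := fun v =>
    (div_nonneg (by exact_mod_cast h.nonneg u v) hN'.le).trans (h.le u v)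
  rw [abs_of_nonneg (h.nonneg u v)]
  have h1 : (X u v : ℝ) / N ≤ 1 := (h.le u v).trans
    ((Finset.single_le_sum (f := A u) (fun v _ => h0 v) (Finset.mem_univ v)).trans (hA u))
  rw [div_le_one hN'] at h1
  exact_mod_cast h1

/-- The rounding errors of repeated squaring. -/
theorem IsChain.below_squaring [DecidableEq ι] {A B : Matrix ι ι ℝ} (h : IsChain A B) (hN : 0 < N) (i : ℕ) :
    let p := squaring N (A.map fun a => ⌊(N : ℝ) * a⌋) (B.map fun a => ⌊(N : ℝ) * a⌋) i
    Below N (Fintype.card ι / N * 4 ^ i) p.1 (A ^ 2 ^ i) ∧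
      Below N (Fintype.card ι / N * 4 ^ i) p.2 (absorbed A B (2 ^ i)) := by
  induction i with
  | zero =>
    simp only [squaring, pow_zero, mul_one, pow_one]
    refine ⟨Below.floor hN h.nonneg_left, ?_⟩
    simpa [absorbed] using Below.floor hN h.nonneg_right
  | succ i ih =>
    obtain ⟨h1, h2⟩ := ih
    have hc := h.pow (2 ^ i)
    have hN' : (0 : ℝ) < N := by exact_mod_cast hN
    have hd : (0 : ℝ) ≤ Fintype.card ι / N := div_nonneg (Nat.cast_nonneg _) hN'.le
    -- With old error `e` and `d = card ι / N ≤ e`, the new errors are `2 * e + d` and `3 * e + d`,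
    -- both at most `4 * e`.
    have h4 : (Fintype.card ι / N : ℝ) ≤ Fintype.card ι / N * 4 ^ i :=
      le_mul_of_one_le_right hd (one_le_pow₀ (by norm_num))
    have hs : 2 ^ (i + 1) = 2 ^ i + 2 ^ i := by ring
    rw [hs, pow_add A, absorbed_add]
    refine ⟨(h1.mul_div hN h1 hc.left_row_le hc.left_row_le).mono ?_,
      (h2.add (h1.mul_div hN h2 hc.left_row_le hc.right_row_le)).mono ?_⟩ <;>
    · rw [pow_succ]
      linarith

end AbsorbingChain

/-! ### The shortcut matrix as absorption probabilities of a chain -/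

namespace RandomWalk

open AbsorbingChain

variable {n : ℕ}

/-- The probability of a step from a vertex with neighbourhood `N` to `v`. -/
noncomputable def stepProb (N : Set (Fin n)) (v : Fin n) : ℝ :=
  open Classical in if v ∈ N then (N.ncard : ℝ)⁻¹ else 0

theorem stepProb_nonneg (N : Set (Fin n)) (v : Fin n) : 0 ≤ stepProb N v := by
  unfold stepProb
  split_ifs <;> positivity

theorem step_toReal {G : SimpleGraph (Fin n)} {u : Fin n} (h : (G.neighborSet u).Nonempty)
    (v : Fin n) : (step G u v).toReal = stepProb (G.neighborSet u) v := by
  classical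
  have h' : (G.neighborFinset u).Nonempty := by
    obtain ⟨w, hw⟩ := h
    exact ⟨w, by simpa using hw⟩
  have hc : (G.neighborFinset u).card = (G.neighborSet u).ncard :=
    (Set.ncard_eq_toFinset_card' _).symm
  unfold step
  split_ifs
  · rw [PMF.uniformOfFinset_apply, stepProb]
    by_cases hv : v ∈ G.neighborSet u
    · rw [if_pos (by simpa using hv), if_pos hv, ← hc]
      simp
    · rw [if_neg (by simpa using hv), if_neg hv]
      simp

theorem sum_stepProb {N : Set (Fin n)} (h : N.Nonempty) : ∑ v, stepProb N v = 1 := by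
  classical
  have : (N.ncard : ℝ) ≠ 0 := by
    have := (Set.ncard_pos (Set.toFinite N)).2 h
    exact_mod_cast this.ne'
  simp only [stepProb]
  rw [← Finset.sum_filter, Finset.sum_const, nsmul_eq_mul, ← Set.ncard_coe_finset]
  simp [this]

/-- The walk on `G`, stopped one step before it enters `S`: the probability of a step outside
`S`. -/
noncomputable def avoid (G : SimpleGraph (Fin n)) (S : Set (Fin n)) : Matrix (Fin n) (Fin n) ℝ :=
  fun u v => open Classical in if v ∈ S then 0 else stepProb (G.neighborSet u) v

/-- The diagonal matrix of the probabilities of a step into `S`. -/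
noncomputable def enter (G : SimpleGraph (Fin n)) (S : Set (Fin n)) : Matrix (Fin n) (Fin n) ℝ :=
  Matrix.diagonal fun u =>
    ∑ v, open Classical in if v ∈ S then stepProb (G.neighborSet u) v else 0

theorem isChain_avoid_enter {G : SimpleGraph (Fin n)} (hG : ∀ u, (G.neighborSet u).Nonempty)
    (S : Set (Fin n)) : IsChain (avoid G S) (enter G S) where
  nonneg_left u v := by
    unfold avoid
    split_ifs
    · exact le_rfl
    · exact stepProb_nonneg _ _
  nonneg_right u v := by
    rw [enter, Matrix.diagonal_apply]
    split_ifs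
    · refine Finset.sum_nonneg fun w _ => ?_
      split_ifs
      · exact stepProb_nonneg _ _
      · exact le_rfl
    · exact le_rfl
  row_sum u := by
    simp only [enter, Matrix.diagonal_apply, Finset.sum_ite_eq, Finset.mem_univ, if_true, avoid]
    rw [← Finset.sum_add_distrib, ← sum_stepProb (hG u)]
    refine Finset.sum_congr rfl fun v _ => ?_
    split_ifs <;> simp

instance (G : SimpleGraph (Fin n)) (u : Fin n) : IsProbabilityMeasure (walk G u) := by
  unfold walk
  infer_instance

theorem measurableSet_history (t : ℕ) (E : Set (Finset.Iic t → Fin n)) :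
    MeasurableSet E := E.toFinite.measurableSet

/-- The Markov property: given the history up to time `t`, the walk takes a step from `x t`. -/
theorem walk_step {G : SimpleGraph (Fin n)} (hG : ∀ u, (G.neighborSet u).Nonempty)
    (u : Fin n) (t : ℕ) (E : Set (Finset.Iic t → Fin n)) (v : Fin n) (R : Set (Fin n))
    (hE : ∀ y ∈ E, y ⟨t, Finset.mem_Iic.2 le_rfl⟩ = v) :
    (walk G u).real {x | Preorder.frestrictLe t x ∈ E ∧ x (t + 1) ∈ R} =
      (walk G u).real {x | Preorder.frestrictLe t x ∈ E} *
        ∑ w, open Classical in if w ∈ R then stepProb (G.neighborSet v) w else 0 := by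
  classical
  have hmE := measurableSet_history t E
  have hmR : MeasurableSet R := R.toFinite.measurableSet
  -- The joint law of the history and the next vertex is a composition product; on `E` the kernel is
  -- constant, so the integral factors.
  have key := Kernel.partialTraj_compProd_eq_map_traj (X := fun _ => Fin n) (κ := stepKernel G) (Nat.zero_le t)
    (x₀ := fun _ => u)
  have h1 := congrArg (fun μ => μ (E ×ˢ R)) key
  rw [Measure.compProd_apply_prod hmE hmR, Measure.map_apply (by fun_prop) (hmE.prod hmR)] at h1
  have h2 : ∫⁻ y in E, stepKernel G t y R ∂(Kernel.partialTraj (X := fun _ => Fin n) (stepKernel G) 0 t fun _ => u) =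
      ∫⁻ y in E, (step G v).toMeasure R ∂(Kernel.partialTraj (X := fun _ => Fin n) (stepKernel G) 0 t fun _ => u) := by
    refine setLIntegral_congr_fun hmE fun y hy => ?_
    simp only [stepKernel, Kernel.ofFunOfCountable, Kernel.coe_mk, hE y hy]
  rw [h2, setLIntegral_const, ← Kernel.traj_map_frestrictLe_apply,
    Measure.map_apply (by fun_prop) hmE] at h1
  have h3 : ((step G v).toMeasure R).toReal =
      ∑ w, if w ∈ R then stepProb (G.neighborSet v) w else 0 := by
    rw [PMF.toMeasure_apply_fintype, ENNReal.toReal_sum]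
    · refine Finset.sum_congr rfl fun w _ => ?_
      rw [Set.indicator_apply]
      split_ifs
      · exact step_toReal (hG v) w
      · rfl
    · intro w _
      rw [Set.indicator_apply]
      split_ifs
      · exact PMF.apply_ne_top _ _
      · exact ENNReal.zero_ne_top
  have h4 := congrArg ENNReal.toReal h1
  rw [ENNReal.toReal_mul, h3, mul_comm] at h4
  exact h4.symm

/-- The histories up to time `t` that avoid `S` after time `0` and end at `v`. -/
def avoiding (S : Set (Fin n)) (t : ℕ) (v : Fin n) : Set (Finset.Iic t → Fin n) :=
  {y | (∀ i (hi : i ≤ t), 0 < i → y ⟨i, Finset.mem_Iic.2 hi⟩ ∉ S) ∧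
    y ⟨t, Finset.mem_Iic.2 le_rfl⟩ = v}

theorem walk_map_zero (G : SimpleGraph (Fin n)) (u : Fin n) (E : Set (Finset.Iic 0 → Fin n)) :
    (walk G u).real {x | Preorder.frestrictLe 0 x ∈ E} =
      open Classical in if (fun _ => u) ∈ E then 1 else 0 := by
  classical
  have hmE := measurableSet_history 0 E
  have h := congrArg (fun μ => μ E) (Kernel.traj_map_frestrictLe_apply (X := fun _ => Fin n)
    (κ := stepKernel G) 0 0 (fun _ => u))
  rw [Measure.map_apply (by fun_prop) hmE, Kernel.partialTraj_self, Kernel.id_apply,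
    Measure.dirac_apply' _ hmE] at h
  have h' := congrArg ENNReal.toReal h
  rw [Set.indicator_apply] at h'
  refine Eq.trans h' ?_
  split_ifs <;> simp

theorem measurableSet_coord (t : ℕ) (R : Set (Fin n)) : MeasurableSet {x : ℕ → Fin n | x t ∈ R} :=
  measurable_pi_apply t R.toFinite.measurableSet

theorem measurableSet_avoiding (S : Set (Fin n)) (t : ℕ) (v : Fin n) :
    MeasurableSet {x : ℕ → Fin n | Preorder.frestrictLe t x ∈ avoiding S t v} :=
  Preorder.measurable_frestrictLe (X := fun _ => Fin n) t (measurableSet_history t _)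

theorem sum_measureReal_coord (μ : Measure (ℕ → Fin n)) [IsFiniteMeasure μ] (t : ℕ)
    (s : Set (ℕ → Fin n)) : μ.real s = ∑ v, μ.real (s ∩ {x | x t = v}) := by
  have h := sum_measureReal_preimage_singleton (μ := μ.restrict s) (f := fun x => x t)
    (Finset.univ : Finset (Fin n)) fun v _ => measurableSet_coord t {v}
  simp only [Finset.coe_univ, Set.preimage_univ, measureReal_restrict_apply_univ] at h
  rw [← h]
  refine Finset.sum_congr rfl fun v _ => ?_
  refine (measureReal_restrict_apply (measurableSet_coord t {v})).trans ?_
  rw [Set.inter_comm]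
  rfl

/-- The probability that the walk avoids `S` at times `1, …, t` and is at `v` at time `t`. -/
theorem walk_avoiding {G : SimpleGraph (Fin n)} (hG : ∀ u, (G.neighborSet u).Nonempty)
    (S : Set (Fin n)) (u : Fin n) (t : ℕ) (v : Fin n) :
    (walk G u).real {x | Preorder.frestrictLe t x ∈ avoiding S t v} = (avoid G S ^ t) u v := by
  classical
  induction t generalizing v with
  | zero =>
    have h : (fun _ => u) ∈ avoiding S 0 v ↔ u = v :=
      ⟨fun h => h.2, fun h => ⟨fun i hi h0 => by omega, h⟩⟩
    rw [walk_map_zero, pow_zero, Matrix.one_apply]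
    split_ifs <;> tauto
  | succ t ih =>
    rw [sum_measureReal_coord _ t, pow_succ, Matrix.mul_apply]
    refine Finset.sum_congr rfl fun w _ => ?_
    have hset : {x : ℕ → Fin n | Preorder.frestrictLe (t + 1) x ∈ avoiding S (t + 1) v} ∩
        {x | x t = w} =
        {x : ℕ → Fin n | Preorder.frestrictLe t x ∈ avoiding S t w ∧ x (t + 1) ∈ {v} \ S} := by
      ext x
      simp only [avoiding, Set.mem_inter_iff, Set.mem_ofPred_eq, Preorder.frestrictLe_apply,
        Set.mem_sdiff, Set.mem_singleton_iff]
      constructor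
      · rintro ⟨⟨h1, h2⟩, h3⟩
        exact ⟨⟨fun i hi h0 => h1 i (by omega) h0, h3⟩, h2, h1 (t + 1) le_rfl (by omega)⟩
      · rintro ⟨⟨h1, h3⟩, h2, h4⟩
        refine ⟨⟨fun i hi h0 => ?_, h2⟩, h3⟩
        rcases Nat.lt_or_ge t i with h | h
        · obtain rfl : i = t + 1 := by omega
          exact h4
        · exact h1 i h h0
    rw [hset, walk_step hG u t _ w _ (fun y hy => hy.2), ih]
    congr 1
    simp only [avoid, Set.mem_sdiff, Set.mem_singleton_iff]
    by_cases hv : v ∈ S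
    · rw [if_pos hv]
      refine Finset.sum_eq_zero fun x _ => if_neg ?_
      rintro ⟨rfl, h⟩
      exact h hv
    · rw [if_neg hv, Finset.sum_eq_single v]
      · rw [if_pos ⟨rfl, hv⟩]
      · intro x _ hx
        rw [if_neg fun h => hx h.1]
      · simp

/-- The probability that the walk avoids `S` at times `1, …, t`, is at `v` at time `t`, and enters
`S` in the next step. -/
theorem walk_entering {G : SimpleGraph (Fin n)} (hG : ∀ u, (G.neighborSet u).Nonempty)
    (S : Set (Fin n)) (u : Fin n) (t : ℕ) (v : Fin n) :
    (walk G u).real {x | Preorder.frestrictLe t x ∈ avoiding S t v ∧ x (t + 1) ∈ S} =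
      (avoid G S ^ t * enter G S) u v := by
  rw [walk_step hG u t _ v _ (fun y hy => hy.2), walk_avoiding hG, enter, Matrix.mul_diagonal]

/-- The event that defines the shortcut graph, by the time of the last step before `S`. -/
theorem mem_shortcut_event (S : Set (Fin n)) (v : Fin n) (x : ℕ → Fin n) :
    (∃ j, IsLeast {i : ℕ | 0 < i ∧ x i ∈ S} j ∧ x (j - 1) = v) ↔
      ∃ t, Preorder.frestrictLe t x ∈ avoiding S t v ∧ x (t + 1) ∈ S := by
  constructor
  · rintro ⟨j, ⟨⟨hj, hjS⟩, hle⟩, hv⟩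
    obtain ⟨t, rfl⟩ : ∃ t, j = t + 1 := ⟨j - 1, by omega⟩
    refine ⟨t, ⟨fun i hi h0 hS => ?_, hv⟩, hjS⟩
    have := hle ⟨h0, hS⟩
    omega
  · rintro ⟨t, ⟨h1, h2⟩, h3⟩
    refine ⟨t + 1, ⟨⟨by omega, h3⟩, fun i hi => ?_⟩, h2⟩
    by_contra! h
    exact h1 i (by omega) hi.1 hi.2

/-- Entering `S` for the first time at different times gives disjoint events, so their probabilities
add up. -/
theorem absorbed_le_shortcut {G : SimpleGraph (Fin n)} (hG : ∀ u, (G.neighborSet u).Nonempty)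
    (S : Set (Fin n)) (T : ℕ) (u v : Fin n) :
    absorbed (avoid G S) (enter G S) T u v ≤ shortcut G S u v := by
  rw [absorbed, Matrix.sum_apply]
  simp only [← walk_entering hG]
  rw [← measureReal_biUnion_finset]
  · refine measureReal_mono fun x hx => ?_
    simp only [Set.mem_iUnion] at hx
    obtain ⟨t, -, h⟩ := hx
    exact (mem_shortcut_event S v x).2 ⟨t, h⟩
  · intro s _ t _ hst
    refine Set.disjoint_left.2 fun x hs ht => ?_
    rcases lt_or_gt_of_ne hst with h | h
    · exact ht.1.1 (s + 1) h (by omega) hs.2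
    · exact hs.1.1 (t + 1) h (by omega) ht.2
  · exact fun t _ => (measurableSet_avoiding S t v).inter (measurableSet_coord (t + 1) S)

/-- A walk that has not entered `S` by time `T` avoids it at times `1, …, T`; apply the union bound
over the entering time and over the position at time `T`. -/
theorem shortcut_le_absorbed_add {G : SimpleGraph (Fin n)}
    (hG : ∀ u, (G.neighborSet u).Nonempty) (S : Set (Fin n)) (T : ℕ) (u v : Fin n) :
    shortcut G S u v ≤
      absorbed (avoid G S) (enter G S) T u v + ∑ w, (avoid G S ^ T) u w := by
  rw [absorbed, Matrix.sum_apply]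
  simp only [← walk_entering hG, ← walk_avoiding hG]
  refine le_trans ?_ (add_le_add (measureReal_biUnion_finset_le _ _)
    ((measureReal_biUnion_finset_le _ _)))
  refine le_trans ?_ (measureReal_union_le _ _)
  refine measureReal_mono fun x hx => ?_
  obtain ⟨t, ht⟩ := (mem_shortcut_event S v x).1 hx
  simp only [Set.mem_union, Set.mem_iUnion]
  rcases lt_or_ge t T with h | h
  · exact Or.inl ⟨t, Finset.mem_range.2 h, ht⟩
  · exact Or.inr ⟨x T, Finset.mem_univ _, fun i hi h0 => ht.1.1 i (hi.trans h) h0, rfl⟩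

theorem shortcut_empty (G : SimpleGraph (Fin n)) (u v : Fin n) : shortcut G ∅ u v = 0 := by
  simp [shortcut, IsLeast]

end RandomWalk

/-! ### Polynomial decay of the probability of avoiding `S` -/

namespace RandomWalk

open AbsorbingChain

variable {n : ℕ}

theorem abs_sub_le_length_mul {V : Type*} {G : SimpleGraph V} {h : V → ℝ} {D : ℝ}
    (hD : ∀ u v, G.Adj u v → |h u - h v| ≤ D) {u v : V} (p : G.Walk u v) :
    |h u - h v| ≤ p.length * D := by
  induction p with
  | nil => simp
  | cons huv p ih =>
    rw [SimpleGraph.Walk.length_cons]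
    push_cast
    linarith [abs_sub_le _ _ _ |>.trans (add_le_add (hD _ _ huv) ih)]

/-- A nonnegative function that vanishes on `S` and whose graph Laplacian is at most `n` outside
`S` is polynomially bounded, by an estimate of its Dirichlet energy. -/
theorem le_of_laplacian_le {G : SimpleGraph (Fin n)} (hG : G.Connected) {S : Set (Fin n)}
    (hS : S.Nonempty) {h : Fin n → ℝ} (h0 : ∀ u, 0 ≤ h u) (hhS : ∀ u ∈ S, h u = 0)
    (hL : ∀ u, u ∉ S → ∑ v, (open Classical in if G.Adj u v then h u - h v else 0) ≤ n)
    (u : Fin n) : h u ≤ 2 * (n : ℝ) ^ 4 := by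
  classical
  have : Nonempty (Fin n) := ⟨u⟩
  obtain ⟨m, -, hm⟩ := Finset.exists_max_image Finset.univ h Finset.univ_nonempty
  set H := h m with hH
  have hH0 : 0 ≤ H := h0 m
  set w : Fin n → Fin n → ℝ := fun u v => if G.Adj u v then 1 else 0 with hw
  have hw0 : ∀ u v, 0 ≤ w u v := fun u v => by simp only [hw]; split_ifs <;> norm_num
  have hwc : ∀ u v, w u v = w v u := fun u v => by simp only [hw, G.adj_comm]
  -- Summation by parts: the energy is twice the sum of `h` times its Laplacian. Vertices of `S`
  -- contribute nothing, each other one at most `n * H`.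
  have hE : ∑ u, ∑ v, w u v * (h u - h v) ^ 2 ≤ 2 * (n : ℝ) ^ 2 * H := by
    have e1 : ∑ u, ∑ v, w u v * (h u - h v) ^ 2 =
        ∑ u, ∑ v, w u v * (h u * (h u - h v)) + ∑ u, ∑ v, w u v * (h v * (h v - h u)) := by
      simp only [← Finset.sum_add_distrib]
      exact Finset.sum_congr rfl fun u _ => Finset.sum_congr rfl fun v _ => by ring
    have e2 : ∑ u, ∑ v, w u v * (h v * (h v - h u)) = ∑ u, ∑ v, w u v * (h u * (h u - h v)) := by
      rw [Finset.sum_comm]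
      exact Finset.sum_congr rfl fun u _ => Finset.sum_congr rfl fun v _ => by rw [hwc]
    have e3 : ∀ u, ∑ v, w u v * (h u * (h u - h v)) ≤ n * H := by
      intro u
      have : ∑ v, w u v * (h u * (h u - h v)) =
          h u * ∑ v, (if G.Adj u v then h u - h v else 0) := by
        rw [Finset.mul_sum]
        refine Finset.sum_congr rfl fun v _ => ?_
        simp only [hw]
        split_ifs <;> ring
      rw [this]
      by_cases hu : u ∈ S
      · rw [hhS u hu, zero_mul]
        positivity
      · calc _ ≤ h u * n := mul_le_mul_of_nonneg_left (hL u hu) (h0 u)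
          _ ≤ H * n := mul_le_mul_of_nonneg_right (hm u (Finset.mem_univ _)) (Nat.cast_nonneg n)
          _ = _ := mul_comm _ _
    have e4 : ∑ u, ∑ v, w u v * (h u * (h u - h v)) ≤ n * (n * H) :=
      (Finset.sum_le_sum fun u _ => e3 u).trans (by simp)
    rw [e1, e2]
    linarith
  have hedge : ∀ u v, G.Adj u v → |h u - h v| ≤ √(2 * (n : ℝ) ^ 2 * H) := by
    intro u v huv
    refine Real.abs_le_sqrt (le_trans ?_ hE)
    have hnn : ∀ u v, 0 ≤ w u v * (h u - h v) ^ 2 := fun u v => mul_nonneg (hw0 u v) (sq_nonneg _)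
    calc (h u - h v) ^ 2 = w u v * (h u - h v) ^ 2 := by simp [hw, huv]
      _ ≤ ∑ v, w u v * (h u - h v) ^ 2 :=
        Finset.single_le_sum (f := fun v => w u v * (h u - h v) ^ 2) (fun v _ => hnn u v)
          (Finset.mem_univ v)
      _ ≤ _ := Finset.single_le_sum (f := fun u => ∑ v, w u v * (h u - h v) ^ 2)
        (fun u _ => Finset.sum_nonneg fun v _ => hnn u v) (Finset.mem_univ u)
  obtain ⟨s, hs⟩ := hS
  obtain ⟨p, hp⟩ := (hG.preconnected m s).exists_isPath
  have hlen : (p.length : ℝ) ≤ n := by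
    have := hp.length_lt
    rw [Fintype.card_fin] at this
    exact_mod_cast this.le
  -- A path from the maximum to `S` has at most `n` edges, each changing `h` by at most the root of
  -- the energy; squaring then bounds `H`.
  have hHle : H ≤ n * √(2 * (n : ℝ) ^ 2 * H) := by
    have := abs_sub_le_length_mul hedge p
    rw [hhS s hs, sub_zero] at this
    exact (le_abs_self _).trans (this.trans (mul_le_mul_of_nonneg_right hlen (Real.sqrt_nonneg _)))
  have hsq : H * H ≤ 2 * (n : ℝ) ^ 4 * H := by
    calc H * H ≤ (n * √(2 * (n : ℝ) ^ 2 * H)) * (n * √(2 * (n : ℝ) ^ 2 * H)) :=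
          mul_self_le_mul_self hH0 hHle
      _ = n ^ 2 * (√(2 * (n : ℝ) ^ 2 * H) * √(2 * (n : ℝ) ^ 2 * H)) := by ring
      _ = _ := by rw [Real.mul_self_sqrt (by positivity)]; ring
  refine (hm u (Finset.mem_univ _)).trans ?_
  rcases hH0.eq_or_lt with h | h
  · rw [← h]
    positivity
  · exact le_of_mul_le_mul_right hsq h

/-- The walk from any vertex avoids `S` during `T + 1` steps with probability at most
`2 * n ^ 4 / T`. -/
theorem mul_sum_avoid_pow_le {G : SimpleGraph (Fin n)} (hG : G.Connected)
    (hN : ∀ u, (G.neighborSet u).Nonempty) {S : Set (Fin n)} (hS : S.Nonempty) (T : ℕ)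
    (u : Fin n) : T * ∑ w, (avoid G S ^ (T + 1)) u w ≤ 2 * (n : ℝ) ^ 4 := by
  classical
  have hc := isChain_avoid_enter hN S
  set A := avoid G S with hA
  set p : ℕ → Fin n → ℝ := fun t u => ∑ w, (A ^ t) u w with hp
  have hp0 : ∀ t u, 0 ≤ p t u := fun t u => Finset.sum_nonneg fun w _ => (hc.pow t).nonneg_left u w
  have hsucc : ∀ t u, p (t + 1) u = ∑ v, A u v * p t v := by
    intro t u
    simp only [hp]
    rw [pow_succ', row_sum_mul]
  have hanti : ∀ u, Antitone fun t => p t u := by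
    refine fun u => antitone_nat_of_succ_le fun t => ?_
    simp only [hp]
    rw [pow_succ, row_sum_mul]
    exact Finset.sum_le_sum fun w _ =>
      mul_le_of_le_one_right ((hc.pow t).nonneg_left u w) (hc.left_row_le w)
  -- Off `S`, `h u` is the expectation of the hitting time capped at `T`. On `S` it is reset to
  -- zero, since `p` only counts visits at positive times.
  set h : Fin n → ℝ := fun u => if u ∈ S then 0 else ∑ t ∈ Finset.range T, p t u with hh
  have hAh : ∀ u, ∑ v, stepProb (G.neighborSet u) v * h v =
      ∑ t ∈ Finset.range T, p (t + 1) u := by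
    intro u
    simp only [hsucc]
    rw [Finset.sum_comm]
    refine Finset.sum_congr rfl fun v _ => ?_
    rw [← Finset.mul_sum]
    simp only [hh, hA, avoid]
    split_ifs <;> ring
  have hbound : ∀ u, h u ≤ 2 * (n : ℝ) ^ 4 := by
    refine le_of_laplacian_le hG hS (fun u => ?_) (fun u hu => ?_) fun u hu => ?_
    · simp only [hh]
      split_ifs
      · exact le_rfl
      · exact Finset.sum_nonneg fun t _ => hp0 t u
    · simp only [hh, if_pos hu]
    · have hd : ((G.neighborSet u).ncard : ℝ) ≠ 0 := by
        exact_mod_cast ((Set.ncard_pos (Set.toFinite _)).2 (hN u)).ne'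
      have hdn : ((G.neighborSet u).ncard : ℝ) ≤ n := by
        have := Set.ncard_le_ncard (Set.subset_univ (G.neighborSet u)) Set.finite_univ
        rw [Set.ncard_univ, Nat.card_eq_fintype_card, Fintype.card_fin] at this
        exact_mod_cast this
      have e1 : ∀ v, (if G.Adj u v then h u - h v else 0) =
          (G.neighborSet u).ncard * (stepProb (G.neighborSet u) v * (h u - h v)) := by
        intro v
        simp only [stepProb, SimpleGraph.mem_neighborSet]
        split_ifs
        · rw [mul_inv_cancel_left₀ hd]
        · ring
      have e2 : ∑ v, stepProb (G.neighborSet u) v * (h u - h v) = 1 - p T u := by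
        simp only [mul_sub, Finset.sum_sub_distrib]
        rw [← Finset.sum_mul, sum_stepProb (hN u), hAh, one_mul]
        have : p 0 u = 1 := by simp [hp, Matrix.one_apply]
        simp only [hh, if_neg hu]
        rw [← Finset.sum_sub_distrib, Finset.sum_range_sub' (fun t => p t u), this]
      calc _ = (G.neighborSet u).ncard * (1 - p T u) := by
            rw [← e2, Finset.mul_sum]
            exact Finset.sum_congr rfl fun v _ => e1 v
        _ ≤ (G.neighborSet u).ncard * 1 :=
            mul_le_mul_of_nonneg_left (by linarith [hp0 T u]) (Nat.cast_nonneg _)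
        _ ≤ n := by rwa [mul_one]
  -- The extra step covers starts in `S`: a surviving first step ends outside `S`, where
  -- monotonicity of `p` gives `T * p T v ≤ h v`.
  change T * p (T + 1) u ≤ _
  rw [hsucc, Finset.mul_sum]
  calc ∑ v, T * (A u v * p T v) ≤ ∑ v, A u v * (2 * (n : ℝ) ^ 4) := by
        refine Finset.sum_le_sum fun v _ => ?_
        by_cases hv : v ∈ S
        · have : A u v = 0 := by simp [hA, avoid, hv]
          simp [this]
        · rw [mul_left_comm]
          refine mul_le_mul_of_nonneg_left (le_trans ?_ (hbound v)) (hc.nonneg_left u v)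
          simp only [hh, if_neg hv]
          calc T * p T v = ∑ t ∈ Finset.range T, p T v := by simp
            _ ≤ _ := Finset.sum_le_sum fun t ht => hanti v (Finset.mem_range.1 ht).le
    _ = (∑ v, A u v) * (2 * (n : ℝ) ^ 4) := by rw [Finset.sum_mul]
    _ ≤ 1 * (2 * (n : ℝ) ^ 4) := mul_le_mul_of_nonneg_right (hc.left_row_le u) (by positivity)
    _ = _ := one_mul _

/-- The walk that is stopped after `T` steps determines the shortcut graph up to a small error. -/
theorem mul_shortcut_sub_absorbed_le {G : SimpleGraph (Fin n)} (hG : G.Connected)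
    (hN : ∀ u, (G.neighborSet u).Nonempty) (S : Set (Fin n)) (T : ℕ) (u v : Fin n) :
    T * (shortcut G S u v - absorbed (avoid G S) (enter G S) (T + 1) u v) ≤ 2 * (n : ℝ) ^ 4 := by
  -- For `S = ∅` the walk survives forever, but the shortcut matrix is zero.
  rcases S.eq_empty_or_nonempty with rfl | hS
  · rw [shortcut_empty]
    have := ((isChain_avoid_enter hN ∅).pow (T + 1)).nonneg_right u v
    have h1 : (T : ℝ) * (0 - absorbed (avoid G ∅) (enter G ∅) (T + 1) u v) ≤ 0 :=
      mul_nonpos_of_nonneg_of_nonpos (Nat.cast_nonneg T) (by linarith)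
    exact h1.trans (by positivity)
  · refine le_trans ?_ (mul_sum_avoid_pow_le hG hN hS T u)
    refine mul_le_mul_of_nonneg_left ?_ (Nat.cast_nonneg T)
    linarith [shortcut_le_absorbed_add hN S (T + 1) u v]

end RandomWalk

/-! ### The protocol, its precision and its round count -/

namespace CongestedClique

open AbsorbingChain RandomWalk

variable {n : ℕ}

theorem Reaches.iterate {w T : ℕ} {Ω I : Type} (K : ℕ → Ω → Fin n → I)
    (h : ∀ t, Reaches w T (K t) (K (t + 1))) (L : ℕ) : Reaches w (T * L) (K 0) (K L) := by
  induction L with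
  | zero => exact Reaches.local (fun _ a => a) fun _ _ => rfl
  | succ L ih => exact ih.trans (h L)

/-- One squaring takes two matrix multiplications. -/
theorem Reaches.squarings {w T : ℕ} {Ω : Type} {N : ℤ} (A B : Ω → Matrix (Fin n) (Fin n) ℤ)
    (hmul : ∀ X Y : Ω → Matrix (Fin n) (Fin n) ℤ,
      (∀ ω i j, |X ω i j| ≤ N) → (∀ ω i j, |Y ω i j| ≤ N) →
      Reaches w T (fun ω i => (X ω i, Y ω i)) (fun ω i => (X ω * Y ω) i))
    (hA : ∀ t ω i j, |(squaring N (A ω) (B ω) t).1 i j| ≤ N)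
    (hB : ∀ t ω i j, |(squaring N (A ω) (B ω) t).2 i j| ≤ N) (L : ℕ) :
    Reaches w ((T + T) * L) (fun ω i => (A ω i, B ω i))
      (fun ω i => ((squaring N (A ω) (B ω) L).1 i, (squaring N (A ω) (B ω) L).2 i)) := by
  refine Reaches.iterate
    (fun t ω i => ((squaring N (A ω) (B ω) t).1 i, (squaring N (A ω) (B ω) t).2 i))
    (fun t => ?_) L
  set P := fun ω => (squaring N (A ω) (B ω) t).1 with hP
  set Q := fun ω => (squaring N (A ω) (B ω) t).2 with hQ
  have h1 := (hmul P P (hA t) (hA t)).keep (fun ω i => (P ω i, Q ω i))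
  have h2 := (hmul P Q (hA t) (hB t)).keep (fun ω i => ((P ω * P ω) i, Q ω i))
  have l1 : Reaches w 0 (fun ω i => (P ω i, Q ω i))
      (fun ω i => ((P ω i, P ω i), (P ω i, Q ω i))) :=
    Reaches.local (fun _ p => ((p.1, p.1), p)) fun _ _ => rfl
  have l2 : Reaches w 0 (fun ω i => ((P ω * P ω) i, (P ω i, Q ω i)))
      (fun ω i => ((P ω i, Q ω i), ((P ω * P ω) i, Q ω i))) :=
    Reaches.local (fun _ p => (p.2, (p.1, p.2.2))) fun _ _ => rfl
  have l3 : Reaches w 0 (fun ω i => ((P ω * Q ω) i, ((P ω * P ω) i, Q ω i)))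
      (fun ω i => ((squaring N (A ω) (B ω) (t + 1)).1 i,
        (squaring N (A ω) (B ω) (t + 1)).2 i)) :=
    Reaches.local (fun _ p => (fun j => p.2.1 j / N, fun j => p.2.2 j + p.1 j / N))
      fun _ _ => rfl
  have := (((l1.trans h1).trans l2).trans h2).trans l3
  simpa only [zero_add, add_zero] using this

/-- The fixed-point approximation, with unit `1 / N`, of the transition matrix of the shortcut
graph after `L` squarings. -/
noncomputable def approx (N : ℤ) (L : ℕ) (G : SimpleGraph (Fin n)) (S : Set (Fin n)) :
    Matrix (Fin n) (Fin n) ℤ :=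
  (squaring N ((avoid G S).map fun a => ⌊(N : ℝ) * a⌋)
    ((enter G S).map fun a => ⌊(N : ℝ) * a⌋) L).2

theorem neighborSet_nonempty (hn : 2 ≤ n) {G : SimpleGraph (Fin n)} (hG : G.Connected)
    (u : Fin n) : (G.neighborSet u).Nonempty := by
  have : Nontrivial (Fin n) := Fin.nontrivial_iff_two_le.2 hn
  exact hG.preconnected.exists_adj_of_nontrivial u

/-- Once membership in `S` is announced, row `i` of `avoid` and of `enter` depends only on the
neighbourhood of `i`. The last round sends entry `(i, j)` to machine `j`, which fits because entries
lie between `0` and `N < 2 ^ w`. -/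
theorem reaches_approx (hn : 2 ≤ n) {w T : ℕ} {N : ℕ} (hN : 0 < N) (hw : N < 2 ^ w)
    (hmul : ∀ {Ω : Type} (X Y : Ω → Matrix (Fin n) (Fin n) ℤ),
      (∀ ω i j, |X ω i j| ≤ N) → (∀ ω i j, |Y ω i j| ≤ N) →
      Reaches w T (fun ω i => (X ω i, Y ω i)) (fun ω i => (X ω * Y ω) i)) (L : ℕ) :
    Reaches w (1 + (T + T) * L + 1)
      (fun (ω : {G : SimpleGraph (Fin n) // G.Connected} × Set (Fin n)) i =>
        (ω.1.1.neighborSet i, i ∈ ω.2))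
      (fun ω i => (fun j => (approx N L ω.1.1 ω.2 i j / N : ℚ),
        fun j => (approx N L ω.1.1 ω.2 j i / N : ℚ))) := by
  classical
  set Ω := {G : SimpleGraph (Fin n) // G.Connected} × Set (Fin n)
  have hN' : (0 : ℤ) < N := by exact_mod_cast hN
  let A : Ω → Matrix (Fin n) (Fin n) ℤ := fun ω =>
    (avoid ω.1.1 ω.2).map fun a => ⌊((N : ℤ) : ℝ) * a⌋
  let B : Ω → Matrix (Fin n) (Fin n) ℤ := fun ω =>
    (enter ω.1.1 ω.2).map fun a => ⌊((N : ℤ) : ℝ) * a⌋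
  have hc : ∀ ω : Ω, IsChain (avoid ω.1.1 ω.2) (enter ω.1.1 ω.2) := fun ω =>
    isChain_avoid_enter (neighborSet_nonempty hn ω.1.2) ω.2
  have hb := fun (ω : Ω) t => (hc ω).below_squaring hN' t
  have hA : ∀ t ω i j, |(squaring N (A ω) (B ω) t).1 i j| ≤ N := fun t ω i j =>
    (hb ω t).1.abs_le hN' ((hc ω).pow _).left_row_le i j
  have hB : ∀ t ω i j, |(squaring N (A ω) (B ω) t).2 i j| ≤ N := fun t ω i j =>
    (hb ω t).2.abs_le hN' ((hc ω).pow _).right_row_le i j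
  have hB0 : ∀ ω i j, 0 ≤ (squaring N (A ω) (B ω) L).2 i j := fun ω => (hb ω L).2.nonneg
  have s1 := Reaches.exchange_nat (w := w)
    (fun (ω : Ω) i => (ω.1.1.neighborSet i, i ∈ ω.2)) (fun _ p _ => if p.2 then 1 else 0)
    (fun ω i j => by
      have : (if i ∈ ω.2 then 1 else 0) ≤ N := by split_ifs <;> omega
      exact lt_of_le_of_lt this hw)
  have l1 : Reaches w 0
      (fun (ω : Ω) i => ((fun j => if j ∈ ω.2 then 1 else 0 : Fin n → ℕ),
        (ω.1.1.neighborSet i, i ∈ ω.2)))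
      (fun ω i => (A ω i, B ω i)) := by
    refine Reaches.local (fun i p =>
      (fun v => ⌊((N : ℤ) : ℝ) * if p.1 v = 1 then 0 else stepProb p.2.1 v⌋,
        fun v => ⌊((N : ℤ) : ℝ) *
          if i = v then ∑ v, if p.1 v = 1 then stepProb p.2.1 v else 0 else 0⌋))
      fun ω i => ?_
    have h : ∀ v, (if v ∈ ω.2 then 1 else 0 : ℕ) = 1 ↔ v ∈ ω.2 := fun v => by
      split_ifs <;> simp_all
    refine Prod.ext ?_ ?_ <;> funext v
    · simp only [A, Matrix.map_apply, avoid, h]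
    · simp only [B, Matrix.map_apply, enter, Matrix.diagonal_apply, h]
  have s2 := Reaches.squarings A B (fun X Y hX hY => hmul X Y hX hY) hA hB L
  have s3 := Reaches.exchange_nat (w := w)
    (fun (ω : Ω) i => ((squaring N (A ω) (B ω) L).1 i, (squaring N (A ω) (B ω) L).2 i))
    (fun _ p j => (p.2 j).toNat)
    (fun ω i j => by
      have h1 := (le_abs_self _).trans (hB L ω i j)
      have h2 : ((squaring N (A ω) (B ω) L).2 i j).toNat ≤ N := by omega
      exact lt_of_le_of_lt h2 hw)
  refine (((s1.trans l1).trans s2).trans s3).trans (T' := 0)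
    (Reaches.local (fun _ p => (fun j => (p.2.2 j / N : ℚ), fun j => (p.1 j / N : ℚ)))
      fun ω i => ?_)
  refine Prod.ext rfl ?_
  funext j
  have : (((squaring N (A ω) (B ω) L).2 j i).toNat : ℤ) = (squaring N (A ω) (B ω) L).2 j i :=
    Int.toNat_of_nonneg (hB0 ω j i)
  have h' : ((((squaring N (A ω) (B ω) L).2 j i).toNat : ℕ) : ℚ) =
      ((squaring N (A ω) (B ω) L).2 j i : ℤ) := by
    exact_mod_cast congrArg (Int.cast (R := ℚ)) this
  simp only [h']
  rfl

/-- The first error term is truncation after `2 ^ L` steps, the second is rounding. Both only lower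
the value. -/
theorem approx_error (hn : 2 ≤ n) {N : ℕ} (hN : 0 < N) {L : ℕ} (hL : 0 < L)
    {G : SimpleGraph (Fin n)}
    (hG : G.Connected) (S : Set (Fin n)) (u v : Fin n) :
    (approx N L G S u v : ℝ) / N ≤ shortcut G S u v ∧
      shortcut G S u v - approx N L G S u v / N ≤
        2 * (n : ℝ) ^ 4 / (2 ^ L - 1) + n / N * 4 ^ L := by
  have hN' : (0 : ℤ) < N := by exact_mod_cast hN
  have hnb := neighborSet_nonempty hn hG
  have hb := ((isChain_avoid_enter hnb S).below_squaring hN' L).2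
  have hle : (approx N L G S u v : ℝ) / N ≤ absorbed (avoid G S) (enter G S) (2 ^ L) u v :=
    hb.le u v
  refine ⟨hle.trans (absorbed_le_shortcut hnb S _ u v), ?_⟩
  have hr : absorbed (avoid G S) (enter G S) (2 ^ L) u v - (approx N L G S u v : ℝ) / N ≤
      n / N * 4 ^ L := by
    have h1 := hb.row u
    rw [Fintype.card_fin] at h1
    exact (Finset.single_le_sum (f := fun v => absorbed (avoid G S) (enter G S) (2 ^ L) u v -
      (approx N L G S u v : ℝ) / N) (fun v _ => sub_nonneg.2 (hb.le u v))
      (Finset.mem_univ v)).trans h1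
  have ht : shortcut G S u v - absorbed (avoid G S) (enter G S) (2 ^ L) u v ≤
      2 * (n : ℝ) ^ 4 / (2 ^ L - 1) := by
    have h1 := mul_shortcut_sub_absorbed_le hG hnb S (2 ^ L - 1) u v
    have h2 : 1 < 2 ^ L := Nat.one_lt_two_pow hL.ne'
    rw [Nat.sub_add_cancel h2.le, Nat.cast_sub h2.le] at h1
    push_cast at h1
    have h3 : (1 : ℝ) < 2 ^ L := by exact_mod_cast h2
    rwa [le_div_iff₀' (by linarith)]
  linarith

theorem two_pow_clog_le (hn : 2 ≤ n) : 2 ^ Nat.clog 2 n ≤ n ^ 2 := by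
  have h1 := Nat.pow_pred_clog_lt_self (b := 2) one_lt_two (by omega : 1 < n)
  have h2 : 0 < Nat.clog 2 n := Nat.clog_pos one_lt_two hn
  obtain ⟨m, hm⟩ : ∃ m, Nat.clog 2 n = m + 1 := ⟨_, (Nat.succ_pred_eq_of_pos h2).symm⟩
  rw [hm] at h1 ⊢
  simp only [Nat.pred_succ] at h1
  rw [pow_succ, pow_two]
  exact Nat.mul_le_mul h1.le hn

/-- Here `n ^ (p + 7) ≤ 2 ^ L ≤ n ^ (2 * (p + 7))`. The `7` is `4 + 1 + 2`: the factor `n ^ 4`, the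
target `n ^ (p + 1)`, and `n ^ 2 ≥ 4` for the constants. In `N`, the part `n ^ (4 * (p + 7))`
absorbs `4 ^ L`. Each error is at most `1 / n ^ (p + 1)`, and `2 ≤ n`. -/
theorem error_bound_le (hn : 2 ≤ n) (p : ℕ) {N L : ℕ} (hL : L = Nat.clog 2 n * (p + 7))
    (hN : N = n ^ (4 * (p + 7) + p + 2)) :
    2 * (n : ℝ) ^ 4 / (2 ^ L - 1) + n / N * 4 ^ L ≤ 1 / (n : ℝ) ^ p := by
  have hn' : (2 : ℝ) ≤ n := by exact_mod_cast hn
  have hn0 : (0 : ℝ) < n := by linarith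
  have h1 : (n : ℝ) ^ (p + 7) ≤ 2 ^ L := by
    rw [hL, pow_mul]
    exact pow_le_pow_left₀ hn0.le (by exact_mod_cast Nat.le_pow_clog one_lt_two n) _
  have h2 : (2 : ℝ) ^ L ≤ (n : ℝ) ^ (2 * (p + 7)) := by
    rw [hL, pow_mul, pow_mul]
    exact pow_le_pow_left₀ (by positivity) (by exact_mod_cast two_pow_clog_le hn) _
  have h3 : (4 : ℝ) ^ L ≤ (n : ℝ) ^ (4 * (p + 7)) := by
    calc (4 : ℝ) ^ L = 2 ^ L * 2 ^ L := by rw [← mul_pow]; norm_num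
      _ ≤ (n : ℝ) ^ (2 * (p + 7)) * (n : ℝ) ^ (2 * (p + 7)) :=
        mul_le_mul h2 h2 (by positivity) (by positivity)
      _ = _ := by ring
  have h4 : (4 : ℝ) ≤ (n : ℝ) ^ 2 := by nlinarith
  have h5 : (2 : ℝ) ≤ (n : ℝ) ^ (p + 7) :=
    hn'.trans (le_self_pow₀ (by linarith) (by omega))
  have h6 : 2 * (n : ℝ) ^ 4 / (2 ^ L - 1) ≤ 1 / (n : ℝ) ^ (p + 1) := by
    rw [div_le_div_iff₀ (by linarith) (by positivity)]
    have h8 : 4 * ((n : ℝ) ^ 4 * (n : ℝ) ^ (p + 1)) ≤ (n : ℝ) ^ (p + 7) := by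
      calc _ ≤ (n : ℝ) ^ 2 * ((n : ℝ) ^ 4 * (n : ℝ) ^ (p + 1)) :=
            mul_le_mul_of_nonneg_right h4 (by positivity)
        _ = _ := by ring
    linarith
  have h7 : (n : ℝ) / N * 4 ^ L ≤ 1 / (n : ℝ) ^ (p + 1) := by
    have hNp : (N : ℝ) = (n : ℝ) ^ (4 * (p + 7)) * ((n : ℝ) ^ (p + 1) * n) := by
      rw [hN]
      push_cast
      ring
    calc (n : ℝ) / N * 4 ^ L ≤ n / N * (n : ℝ) ^ (4 * (p + 7)) :=
          mul_le_mul_of_nonneg_left h3 (by positivity)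
      _ = _ := by
        rw [hNp]
        field_simp
  calc _ ≤ 1 / (n : ℝ) ^ (p + 1) + 1 / (n : ℝ) ^ (p + 1) := add_le_add h6 h7
    _ = 2 / n * (1 / (n : ℝ) ^ p) := by
      rw [pow_succ]
      field_simp
      norm_num
    _ ≤ 1 * (1 / (n : ℝ) ^ p) :=
      mul_le_mul_of_nonneg_right ((div_le_one hn0).2 hn') (by positivity)
    _ = _ := one_mul _

/-- `⌈c⌉₊` handles the real exponent, and `q` with `1 / a < 2 ^ q ≤ n ^ q` the constant. -/
theorem exists_one_div_pow_le {a : ℝ} (ha : 0 < a) (c : ℝ) :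
    ∃ p : ℕ, ∀ n : ℕ, 2 ≤ n → 1 / (n : ℝ) ^ p ≤ a / (n : ℝ) ^ c := by
  obtain ⟨q, hq⟩ := pow_unbounded_of_one_lt (1 / a) (one_lt_two (α := ℝ))
  refine ⟨⌈c⌉₊ + q, fun n hn => ?_⟩
  have hn' : (2 : ℝ) ≤ n := by exact_mod_cast hn
  have h1 : (n : ℝ) ^ c ≤ (n : ℝ) ^ ⌈c⌉₊ := by
    rw [← Real.rpow_natCast]
    exact Real.rpow_le_rpow_of_exponent_le (by linarith) (Nat.le_ceil c)
  have h2 : 1 ≤ a * (n : ℝ) ^ q := by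
    have := hq.le.trans (pow_le_pow_left₀ (by norm_num) hn' q)
    rwa [div_le_iff₀' ha] at this
  have h0 : (0 : ℝ) < (n : ℝ) ^ c := Real.rpow_pos_of_pos (by linarith) c
  rw [div_le_div_iff₀ (by positivity) h0, pow_add, one_mul]
  calc (n : ℝ) ^ c ≤ (n : ℝ) ^ ⌈c⌉₊ * 1 := by rwa [mul_one]
    _ ≤ (n : ℝ) ^ ⌈c⌉₊ * (a * (n : ℝ) ^ q) := mul_le_mul_of_nonneg_left h2 (by positivity)
    _ = _ := by ring

/-- From `log 2 > 1 / 2` come `2 ≤ 4 * log n` for the two extra rounds and `clog 2 n ≤ 4 * log n`;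
the `8` also counts two products per squaring. Absorbing the extra rounds needs `1 ≤ n ^ α`, hence
`0 ≤ α`. -/
theorem rounds_le (hn : 2 ≤ n) {α C : ℝ} (hα : 0 ≤ α) {T : ℕ} (hT : (T : ℝ) ≤ C * (n : ℝ) ^ α)
    (q : ℕ) : ((1 + (T + T) * (Nat.clog 2 n * q) + 1 : ℕ) : ℝ) ≤
      (4 + 8 * |C| * q) * ((n : ℝ) ^ α * Real.log n ^ 1) := by
  have hn' : (2 : ℝ) ≤ n := by exact_mod_cast hn
  have hX : 1 ≤ (n : ℝ) ^ α := Real.one_le_rpow (by linarith) hα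
  have hlog2 := Real.log_two_gt_d9
  have hlog : Real.log 2 ≤ Real.log n := Real.log_le_log (by norm_num) hn'
  have hclog : (Nat.clog 2 n : ℝ) ≤ 4 * Real.log n := by
    have h1 : (2 : ℝ) ^ Nat.clog 2 n ≤ (n : ℝ) ^ 2 := by exact_mod_cast two_pow_clog_le hn
    have h2 := Real.log_le_log (by positivity) h1
    rw [Real.log_pow, Real.log_pow] at h2
    push_cast at h2
    have h3 : (Nat.clog 2 n : ℝ) * (1 / 2) ≤ Nat.clog 2 n * Real.log 2 :=
      mul_le_mul_of_nonneg_left (by linarith) (Nat.cast_nonneg _)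
    linarith
  set X := (n : ℝ) ^ α
  set ℓ := Real.log n
  have hℓ : 0 ≤ ℓ := by linarith
  have hT' : (T : ℝ) ≤ |C| * X :=
    hT.trans (mul_le_mul_of_nonneg_right (le_abs_self C) (by linarith))
  have h1 : (T : ℝ) * Nat.clog 2 n ≤ |C| * X * (4 * ℓ) :=
    mul_le_mul hT' hclog (Nat.cast_nonneg _) (by positivity)
  have h2 : 2 * q * ((T : ℝ) * Nat.clog 2 n) ≤ 2 * q * (|C| * X * (4 * ℓ)) :=
    mul_le_mul_of_nonneg_left h1 (by positivity)
  have h3 : ℓ ≤ X * ℓ := le_mul_of_one_le_left hℓ hX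
  push_cast
  rw [pow_one]
  linarith

end CongestedClique

theorem mainTheorem10 (α : ℝ) (hα : CongestedClique.MatMulInRounds α)
    (c a : ℝ) (hc : 0 < c) (ha : 0 < a) :
    ∃ (b k : ℕ) (C : ℝ), ∀ n : ℕ, 2 ≤ n → ∀ β : ℝ, a / (n : ℝ) ^ c ≤ β →
      ∃ (A : CongestedClique.Protocol n (b * Nat.clog 2 n)
          (Set (Fin n) × Prop) ((Fin n → ℚ) × (Fin n → ℚ))) (T : ℕ),
        (T : ℝ) ≤ C * ((n : ℝ) ^ α * Real.log n ^ k) ∧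
        ∀ G : SimpleGraph (Fin n), G.Connected → ∀ S : Set (Fin n),
          ∃ Q' : Matrix (Fin n) (Fin n) ℚ,
            SubtractiveApprox (RandomWalk.shortcut G S) Q' β ∧
            ∀ i, A.output (fun m => (G.neighborSet m, m ∈ S)) T i = (Q' i, fun j => Q' j i) := by
  obtain ⟨p, hp⟩ := CongestedClique.exists_one_div_pow_le ha c
  set k := 4 * (p + 7) + p + 2 with hk
  obtain ⟨b, C, hmul⟩ := hα.reaches k
  -- The width serves both the multiplication protocol (`b`) and numbers up to `N = n ^ k` (`k +
  -- 1`). The precision `1 / n ^ p` does not depend on `β`.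
  refine ⟨b + (k + 1), 1, 4 + 8 * |C| * (p + 7 : ℕ), fun n hn β hβ => ?_⟩
  obtain ⟨T, hT, hmul⟩ := hmul n hn
  have hclog : 0 < Nat.clog 2 n := Nat.clog_pos one_lt_two hn
  have hN : 0 < n ^ k := by positivity
  have hw : n ^ k < 2 ^ ((b + (k + 1)) * Nat.clog 2 n) := by
    calc n ^ k ≤ (2 ^ Nat.clog 2 n) ^ k := Nat.pow_le_pow_left (Nat.le_pow_clog one_lt_two n) k
      _ = 2 ^ (Nat.clog 2 n * k) := (pow_mul _ _ _).symm
      _ < _ := Nat.pow_lt_pow_right one_lt_two (by nlinarith)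
  obtain ⟨A, hA⟩ := CongestedClique.reaches_approx hn hN hw (fun X Y hX hY =>
    (hmul X Y (by exact_mod_cast hX) (by exact_mod_cast hY)).mono_width
      (Nat.mul_le_mul_right _ (by omega))) (Nat.clog 2 n * (p + 7))
  refine ⟨A, _, CongestedClique.rounds_le hn hα.nonneg hT (p + 7), fun G hG S => ?_⟩
  refine ⟨fun u v =>
    (CongestedClique.approx (n ^ k : ℕ) (Nat.clog 2 n * (p + 7)) G S u v / (n ^ k : ℕ) : ℚ),
    fun u v => ?_, fun i => hA (⟨G, hG⟩, S) i⟩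
  have h := CongestedClique.approx_error hn hN (Nat.mul_pos hclog (by omega : 0 < p + 7)) hG S u v
  have h' := CongestedClique.error_bound_le hn p rfl rfl
  have hpn := hp n hn
  rw [← hk] at h'
  simp only [Rat.cast_div, Rat.cast_intCast, Rat.cast_natCast]
  exact ⟨h.1, by linarith [h.2]⟩
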